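/- **Weighted complexes.** Let $Z$ be a finite simplicial complex with a weight $m$, i.e. a function $m>0$ on the simplices of $Z$ such that every simplex $\sigma$ that is not maximal satisfies $m(\sigma)=\sum_{\tau} m(\tau)$, the sum running over the simplices $\tau\supset\sigma$ with $\dim\tau=\dim\sigma+1$. Let $\Gamma$ be the fundamental group of (the geometric realization of) $Z$ at a base point. The link $\mathrm{link}(z)$ of a vertex $z$ is the complex of the simplices $\sigma\not\ni z$ such that $\sigma\cup\{z\}$ is a simplex of $Z$, with the weight $m_{\mathrm{link}}(\sigma)=m(\sigma\cup\{z\})$. **Bottom of the spectrum.** For a finite complex $C$ with vertex set $C^0$ and positive weight $m$, a metric space $T$ and a map $g:C^0\to T$, put $$E(g)=\tfrac12\sum_{c\in C^0}\sum_{c'\sim c}m(c,c')\,d(g(c),g(c'))^2,\qquad d(g,\mathrm{bar}(g))^2=\inf_{y\in T}\sum_{c\in C^0}m(c)\,d(g(c),y)^2,$$ where $c'\sim c$ means that $\{c,c'\}$ is an edge (the infimum is attained exactly at the barycenter of $g$, when it exists), and let $$\lambda(C,T)=\inf_g \frac{E(g)}{d(g,\mathrm{bar}(g))^2}\in[0,+\infty],$$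 the infimum running over the nonconstant maps $g:C^0\to T$ (it is $+\infty$ if there are none). **Tangent cones.** For a point $y$ of a CAT(0) space $Y$, the tangent cone $T_yY$ is the set of constant speed geodesics $s$ issuing from $y$ (defined on some interval $[0,\varepsilon]$, $\varepsilon>0$; speed $0$ is allowed), with the distance $d(s,s')=\lim_{t\to0^+}d(s(t),s'(t))/t$, where $s$ and $s'$ are identified if $d(s,s')=0$. **Theorem.** Let $Y$ be a nonempty complete geodesic CAT(0) metric space. Suppose that there is $\lambda>\frac12$ such that $$\lambda(\mathrm{link}(z),T_yY)\ \ge\ \lambda$$ for all vertices $z$ of $Z$ and all points $y$ of $Y$. Then every isometric action of $\Gamma$ on $Y$ has a fixed point. -/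

import Mathlib

open Filter Topology

noncomputable section

/-! ## Metric geometry: geodesic spaces, CAT(0) spaces, tangent cones -/

/-- Any two points are joined by a geodesic segment, parametrized on `[0, 1]` with constant
speed. -/
def IsGeodesicSpace (Y : Type*) [MetricSpace Y] : Prop :=
  ∀ x y : Y, ∃ γ : ℝ → Y, γ 0 = x ∧ γ 1 = y ∧
    ∀ s ∈ Set.Icc (0 : ℝ) 1, ∀ t ∈ Set.Icc (0 : ℝ) 1, dist (γ s) (γ t) = dist x y * |s - t|

/-- A `CAT(0)` space: a geodesic space in which the distance from a vertex `p` of a triangle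
`p, q, r` to a point `u` of the opposite side (that is, in a geodesic space, a point `u` with
`d(q,u) + d(u,r) = d(q,r)`) is at most the corresponding distance in a triangle `p', q', r'` of the
Euclidean plane with the same side lengths. -/
def IsCAT0 (Y : Type*) [MetricSpace Y] : Prop :=
  IsGeodesicSpace Y ∧
    ∀ p q r u : Y, dist q u + dist u r = dist q r →
      ∀ p' q' r' u' : EuclideanSpace ℝ (Fin 2),
        dist p' q' = dist p q → dist p' r' = dist p r → dist q' r' = dist q r →
        dist q' u' = dist q u → dist u' r' = dist u r →
        dist p u ≤ dist p' u'

/-- A geodesic issuing from `y`, of constant speed on some interval `[0, ε]`. (Only the germ at `0+`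
of the function matters below.) -/
structure GeodesicFrom {Y : Type*} [MetricSpace Y] (y : Y) where
  toFun : ℝ → Y
  map_zero : toFun 0 = y
  exists_speed : ∃ v : ℝ, 0 ≤ v ∧ ∃ ε : ℝ, 0 < ε ∧
    ∀ s ∈ Set.Icc (0 : ℝ) ε, ∀ t ∈ Set.Icc (0 : ℝ) ε, dist (toFun s) (toFun t) = v * |s - t|

namespace GeodesicFrom

variable {Y : Type*} [MetricSpace Y] {y : Y}

/-- The quotient `d(γ(t), γ'(t)) / t`, a nondecreasing function of small `t > 0` when `Y` is
`CAT(0)`. -/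
def distQuot (γ γ' : GeodesicFrom y) (t : ℝ) : ℝ := dist (γ.toFun t) (γ'.toFun t) / t

lemma distQuot_bounded (γ γ' : GeodesicFrom y) :
    ∃ b : ℝ, ∀ᶠ t in 𝓝[>] (0 : ℝ), 0 ≤ distQuot γ γ' t ∧ distQuot γ γ' t ≤ b := by
  obtain ⟨v, hv, ε, hε, h⟩ := γ.exists_speed
  obtain ⟨v', hv', ε', hε', h'⟩ := γ'.exists_speed
  refine ⟨v + v', ?_⟩
  filter_upwards [Ioo_mem_nhdsGT (lt_min hε hε')] with t ht
  have ht0 : 0 < t := ht.1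
  have h1 := h t ⟨ht0.le, (ht.2.trans_le (min_le_left _ _)).le⟩ 0 ⟨le_rfl, hε.le⟩
  have h2 := h' 0 ⟨le_rfl, hε'.le⟩ t ⟨ht0.le, (ht.2.trans_le (min_le_right _ _)).le⟩
  rw [γ.map_zero, sub_zero, abs_of_pos ht0] at h1
  rw [γ'.map_zero, zero_sub, abs_neg, abs_of_pos ht0] at h2
  refine ⟨div_nonneg dist_nonneg ht0.le, ?_⟩
  rw [distQuot, div_le_iff₀ ht0]
  calc dist (γ.toFun t) (γ'.toFun t) ≤ dist (γ.toFun t) y + dist y (γ'.toFun t) :=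
        dist_triangle _ _ _
    _ = (v + v') * t := by rw [h1, h2]; ring

lemma isBoundedUnder_le (γ γ' : GeodesicFrom y) :
    IsBoundedUnder (· ≤ ·) (𝓝[>] (0 : ℝ)) (distQuot γ γ') := by
  obtain ⟨b, hb⟩ := distQuot_bounded γ γ'
  exact ⟨b, by simpa using hb.mono fun t ht => ht.2⟩

lemma isBoundedUnder_ge (γ γ' : GeodesicFrom y) :
    IsBoundedUnder (· ≥ ·) (𝓝[>] (0 : ℝ)) (distQuot γ γ') := by
  obtain ⟨b, hb⟩ := distQuot_bounded γ γ'
  exact ⟨0, by simpa using hb.mono fun t ht => ht.1⟩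

/-- The pseudo-distance `d(γ, γ') = lim_{t → 0+} d(γ(t), γ'(t)) / t` between geodesics issuing from
`y`. It is written as an upper limit, so that it makes sense in every metric space; in a `CAT(0)`
space the quotient is monotone in `t` and the upper limit is a limit. -/
instance : PseudoMetricSpace (GeodesicFrom y) where
  dist γ γ' := limsup (distQuot γ γ') (𝓝[>] (0 : ℝ))
  dist_self γ := by
    have h : distQuot γ γ = fun _ => (0 : ℝ) := by
      funext t; simp [distQuot]
    rw [h]; exact limsup_const 0
  dist_comm γ γ' := by
    have h : distQuot γ γ' = distQuot γ' γ := by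
      funext t; simp [distQuot, dist_comm]
    rw [h]
  dist_triangle γ γ' γ'' := by
    have h : distQuot γ γ'' ≤ᶠ[𝓝[>] (0 : ℝ)] distQuot γ γ' + distQuot γ' γ'' := by
      filter_upwards [self_mem_nhdsWithin] with t ht
      have ht0 : (0 : ℝ) < t := ht
      simp only [distQuot, Pi.add_apply, ← add_div]
      exact div_le_div_of_nonneg_right (dist_triangle _ _ _) ht0.le
    refine (limsup_le_limsup h (isBoundedUnder_ge γ γ'').isCoboundedUnder_le
      (isBoundedUnder_le_add (isBoundedUnder_le γ γ') (isBoundedUnder_le γ' γ''))).trans ?_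
    exact limsup_add_le (isBoundedUnder_ge γ γ') (isBoundedUnder_le γ γ')
      (isBoundedUnder_ge γ' γ'').isCoboundedUnder_le (isBoundedUnder_le γ' γ'')

end GeodesicFrom

/-- The tangent cone `T_y Y`: constant speed geodesics issuing from `y`, two of them being
identified when their pseudo-distance vanishes, with the quotient distance. -/
abbrev TangentCone {Y : Type*} [MetricSpace Y] (y : Y) : Type _ :=
  SeparationQuotient (GeodesicFrom y)

/-! ## Weighted finite simplicial complexes, energy and the bottom of the spectrum -/

section Weighted

variable {V : Type*} [Fintype V] [DecidableEq V]

/-- The set of vertices of a complex. -/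
abbrev PreAbstractSimplicialComplex.Vertex (C : PreAbstractSimplicialComplex V) : Type _ :=
  {v : V // {v} ∈ C.faces}

open Classical in
/-- A weight on a finite simplicial complex: a positive function on the simplices such that the
weight of each simplex which is not maximal is the sum of the weights of the simplices of the next
dimension that contain it. (Only the values of `m` on the simplices of `C` matter.) -/
structure IsWeight (C : PreAbstractSimplicialComplex V) (m : Finset V → ℝ) : Prop where
  pos : ∀ σ ∈ C.faces, 0 < m σ
  sum_cofaces : ∀ σ ∈ C.faces, (∃ τ ∈ C.faces, σ ⊂ τ) →
    m σ = ∑ τ : Finset V with τ ∈ C.faces ∧ σ ⊆ τ ∧ τ.card = σ.card + 1, m τ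

/-- The link of the vertex `z`: the simplices `σ` not containing `z` such that `σ ∪ {z}` is a
simplex. -/
def linkComplex (C : PreAbstractSimplicialComplex V) (z : V) : PreAbstractSimplicialComplex V where
  faces := {σ | σ.Nonempty ∧ z ∉ σ ∧ insert z σ ∈ C.faces}
  isRelLowerSet_faces := by
    rintro σ ⟨hne, hz, hσ⟩
    refine ⟨hne, fun τ hτσ hτ => ⟨hτ, fun h => hz (hτσ h), ?_⟩⟩
    exact (C.isRelLowerSet_faces hσ).2 (Finset.insert_subset_insert z hτσ)
      (Finset.insert_nonempty z τ)

/-- The weight `σ ↦ m(σ ∪ {z})` induced on the link of `z`. -/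
def linkWeight (m : Finset V → ℝ) (z : V) : Finset V → ℝ := fun σ => m (insert z σ)

variable (C : PreAbstractSimplicialComplex V) (m : Finset V → ℝ) {T : Type*} [MetricSpace T]

open Classical in
/-- The energy `E(g) = ½ ∑_c ∑_{c' ∼ c} m(c,c') d(g(c), g(c'))²` of a map defined on the vertices,
where `c' ∼ c` means that `c`, `c'` are the endpoints of an edge. -/
def mapEnergy (g : C.Vertex → T) : ℝ :=
  (1 / 2) * ∑ c : C.Vertex, ∑ c' : C.Vertex with c ≠ c' ∧ {c.1, c'.1} ∈ C.faces,
    m {c.1, c'.1} * dist (g c) (g c') ^ 2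

open Classical in
/-- The squared distance `d(g, g')² = ∑_c m(c) d(g(c), g'(c))²` between maps defined on the
vertices. -/
def mapDistSq (g g' : C.Vertex → T) : ℝ :=
  ∑ c : C.Vertex, m {c.1} * dist (g c) (g' c) ^ 2

/-- `b` is a barycenter of `g`: it minimizes the squared distance from `g` to constant maps. -/
def IsBarycenter (g : C.Vertex → T) (b : T) : Prop :=
  ∀ y : T, mapDistSq C m g (fun _ => b) ≤ mapDistSq C m g (fun _ => y)

/-- The squared distance `d(g, bar(g))²` from `g` to its barycenter, that is the minimum of the
squared distance from `g` to a constant map. It is written as an infimum because a tangent cone need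
not be complete (it is the minimum computed in the completion). -/
def barDistSq (g : C.Vertex → T) : ℝ := ⨅ y : T, mapDistSq C m g (fun _ => y)

set_option linter.unusedSectionVars false in
theorem barDistSq_eq_of_isBarycenter {C : PreAbstractSimplicialComplex V} {m : Finset V → ℝ}
    {g : C.Vertex → T} {b : T} (hb : IsBarycenter C m g b) :
    barDistSq C m g = mapDistSq C m g (fun _ => b) := by
  have : Nonempty T := ⟨b⟩
  refine le_antisymm (ciInf_le ⟨mapDistSq C m g (fun _ => b), ?_⟩ b) (le_ciInf hb)
  rintro _ ⟨y, rfl⟩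
  exact hb y

/-- The Rayleigh quotient `RQ(g) = E(g) / d(g, bar(g))²`. -/
def rayleighQuot (g : C.Vertex → T) : ℝ := mapEnergy C m g / barDistSq C m g

variable (T) in
/-- The bottom of the spectrum `λ(C, m, T)`: the infimum of the Rayleigh quotients of the
nonconstant maps from the vertices of `C` to `T` (equal to `+∞` if there is no such map). -/
def spectrumBottom : EReal :=
  ⨅ (g : C.Vertex → T) (_ : ∃ c c', g c ≠ g c'), ((rayleighQuot C m g : ℝ) : EReal)

open Classical in
/-- The geometric realization of a finite complex: the points of the standard simplex whose support
is a simplex, with the topology induced by that of `V → ℝ`. -/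
def geomRealization (C : PreAbstractSimplicialComplex V) : Set (V → ℝ) :=
  {p | p ∈ stdSimplex ℝ V ∧ (Finset.univ.filter fun v => p v ≠ 0) ∈ C.faces}

end Weighted

end

/-!
A homomorphism `ρ` from the fundamental group of `|Z|` to the isometries of `Y` is the same as a
flat bundle over `|Z|` with fiber `Y`, and its fixed points are the flat sections. No universal
cover is needed: after a choice of paths from the base point, `ρ` extends to all paths (`holonomy`),
and the holonomies `h v w` along the edges satisfy the cocycle relation on every simplex, because
closed stars are contractible (`isFlat_straightHolonomy`). Conversely, a section over the vertices
which is flat along edges extends to a section over `|Z|` that is preserved by the holonomy of all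
paths, since a path can be cut into pieces contained in open stars (`exists_parallel_extension`).

It remains to find a flat section over the vertices, that is, a zero of the energy
`E(f) = ½ ∑ m(v,w) d(f v, h v w (f w))²`, the sum running over the oriented edges
(`exists_flat_section`).

* Let `b` be the barycenter of a map `g` from the vertices of a link to `Y`, and replace each value
  of `g` by the initial vector of the geodesic from `b`. By the `CAT(0)` inequality this does not
  increase the energy. The apex is a barycenter of the initial vectors: the points at parameter `t`
  on the geodesics still have `b` as a barycenter (`sum_le_sum_of_isPointAt`), and one lets `t` tend
  to `0`. Hence the spectral condition on the tangent cones gives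
  `λ ∑ m(c) d(g c, b)² ≤ E(g)` (`mul_mapDistSq_le_mapEnergy`).
* Let `F z` be the barycenter of the values of `f` on the link of `z`, transported to the fiber over
  `z`. The energies of `f` on the links add up to at most `E(f)`, so that the sum `Q` of
  `m(v,w) d(F v, h v w (f w))²` over the oriented edges is at most `E(f) / λ`, with `1 / λ < 2`
  (`exists_barycenter_section`).
* Let `f'` be the section at proportion `t` on the geodesics from `f` to `F`. Convexity of the
  squared distance gives `2 E(f') ≤ (1 - t)² 2 E(f) + 2 t (1 - t) Q + t² 2 E(F)`, and
  `E(F) ≤ 10 E(f)`. So `E(f') ≤ (1 - t (2 - 1 / λ) + O(t²)) E(f)`, a definite decay for a small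
  fixed `t`, while `f'` is at distance `O(√E(f))` from `f` (`exists_decay`). Iterating gives
  a Cauchy sequence of sections, whose limit has energy `0` (`exists_zero_of_contracting`).
-/

/-! ### Comparison inequalities in `CAT(0)` spaces -/

/-- `u` is the point of parameter `t` on a constant speed geodesic from `q` to `r`. -/
def IsPointAt {Y : Type*} [MetricSpace Y] (t : ℝ) (q r u : Y) : Prop :=
  dist q u = t * dist q r ∧ dist u r = (1 - t) * dist q r

section CAT0

variable {Y : Type*} [MetricSpace Y]

lemma IsPointAt.map {t : ℝ} {q r u : Y} (h : IsPointAt t q r u) (φ : Y ≃ᵢ Y) :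
    IsPointAt t (φ q) (φ r) (φ u) := by
  simpa only [IsPointAt, φ.dist_eq] using h

lemma IsGeodesicSpace.exists_isPointAt (hY : IsGeodesicSpace Y) {t : ℝ}
    (ht : t ∈ Set.Icc (0 : ℝ) 1) (q r : Y) : ∃ u, IsPointAt t q r u := by
  obtain ⟨γ, rfl, rfl, h⟩ := hY q r
  refine ⟨γ t, ?_, ?_⟩
  · rw [h 0 (by simp) t ht, zero_sub, abs_neg, abs_of_nonneg ht.1, mul_comm]
  · rw [h t ht 1 (by simp), abs_sub_comm, abs_of_nonneg (sub_nonneg.2 ht.2), mul_comm]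

/-- Comparison with the Euclidean plane, where Stewart's theorem gives an equality. -/
lemma IsCAT0.dist_sq_le (hY : IsCAT0 Y) {t : ℝ} (ht : t ∈ Set.Icc (0 : ℝ) 1) {q r u : Y}
    (hu : IsPointAt t q r u) (p : Y) :
    dist p u ^ 2 ≤ (1 - t) * dist p q ^ 2 + t * dist p r ^ 2 - t * (1 - t) * dist q r ^ 2 := by
  obtain ⟨h1, h2⟩ := hu
  rcases (dist_nonneg (x := q) (y := r)).eq_or_lt with ha | ha
  · rw [← ha, mul_zero] at h1
    obtain rfl := dist_eq_zero.1 ha.symm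
    obtain rfl := dist_eq_zero.1 h1
    simp only [dist_self]
    linarith
  have hp1 : dist p q ≤ dist p r + dist q r := by
    simpa [dist_comm] using dist_triangle p r q
  have hp2 : dist p r ≤ dist p q + dist q r := dist_triangle p q r
  have hp3 : dist q r ≤ dist p q + dist p r := by
    simpa [dist_comm] using dist_triangle q p r
  set a := dist q r
  set b := dist p q
  set c := dist p r
  have hb : 0 ≤ b := dist_nonneg
  have hc : 0 ≤ c := dist_nonneg
  -- the apex of the comparison triangle with base from `(0, 0)` to `(a, 0)`
  set x : ℝ := (b ^ 2 - c ^ 2 + a ^ 2) / (2 * a) with hx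
  have hxa : 2 * a * x = b ^ 2 - c ^ 2 + a ^ 2 := by rw [hx]; field_simp
  have hxb : 0 ≤ b ^ 2 - x ^ 2 := by
    have e1 : 0 ≤ 2 * a * (b - x) := by nlinarith
    have e2 : 0 ≤ 2 * a * (b + x) := by nlinarith
    have e3 : 0 ≤ b - x := nonneg_of_mul_nonneg_right e1 (by positivity)
    have e4 : 0 ≤ b + x := nonneg_of_mul_nonneg_right e2 (by positivity)
    nlinarith
  set y : ℝ := √(b ^ 2 - x ^ 2)
  have hy : y ^ 2 = b ^ 2 - x ^ 2 := Real.sq_sqrt hxb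
  have hdist (x₁ y₁ x₂ y₂ : ℝ) : dist (!₂[x₁, y₁] : EuclideanSpace ℝ (Fin 2)) !₂[x₂, y₂]
      = √((x₁ - x₂) ^ 2 + (y₁ - y₂) ^ 2) := by
    simp [EuclideanSpace.dist_eq, Fin.sum_univ_two, Real.dist_eq, sq_abs]
  have key := hY.2 p q r u (by rw [h1, h2]; ring) !₂[x, y] !₂[0, 0] !₂[a, 0] !₂[t * a, 0]
    (by rw [hdist, Real.sqrt_eq_iff_mul_self_eq (by positivity) hb]; linarith)
    (by rw [hdist, Real.sqrt_eq_iff_mul_self_eq (by positivity) hc]; linarith)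
    (by rw [hdist, Real.sqrt_eq_iff_mul_self_eq (by positivity) ha.le]; ring)
    (by
      rw [hdist, h1, Real.sqrt_eq_iff_mul_self_eq (by positivity) (mul_nonneg ht.1 ha.le)]
      ring)
    (by
      rw [hdist, h2, Real.sqrt_eq_iff_mul_self_eq (by positivity)
        (mul_nonneg (sub_nonneg.2 ht.2) ha.le)]
      ring)
  have h0 : dist (!₂[x, y] : EuclideanSpace ℝ (Fin 2)) !₂[t * a, 0] ^ 2
      = (1 - t) * b ^ 2 + t * c ^ 2 - t * (1 - t) * a ^ 2 := by
    rw [hdist, Real.sq_sqrt (by positivity)]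
    linear_combination hy - t * hxa
  rw [← h0]
  exact pow_le_pow_left₀ dist_nonneg key 2

/-- Convexity of the squared distance between two geodesics, with the sides of the quadrilateral
taken into account. -/
lemma IsCAT0.dist_sq_le_of_isPointAt (hY : IsCAT0 Y) {t : ℝ} (ht : t ∈ Set.Icc (0 : ℝ) 1)
    {x₀ x₁ u c₀ c₁ w : Y} (hu : IsPointAt t x₀ x₁ u) (hw : IsPointAt t c₀ c₁ w) :
    dist u w ^ 2 ≤ (1 - t) ^ 2 * dist x₀ c₀ ^ 2
      + t * (1 - t) * (dist x₁ c₀ ^ 2 + dist x₀ c₁ ^ 2) + t ^ 2 * dist x₁ c₁ ^ 2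
      - t * (1 - t) * (dist x₀ x₁ ^ 2 + dist c₀ c₁ ^ 2) := by
  have h := hY.dist_sq_le ht hw u
  have h₀ := mul_le_mul_of_nonneg_left (hY.dist_sq_le ht hu c₀) (sub_nonneg.2 ht.2)
  have h₁ := mul_le_mul_of_nonneg_left (hY.dist_sq_le ht hu c₁) ht.1
  simp only [dist_comm c₀, dist_comm c₁] at h₀ h₁
  linarith

/-- Two geodesics issuing from the same point diverge at least linearly. -/
lemma IsCAT0.dist_le_mul (hY : IsCAT0 Y) {t : ℝ} (ht : t ∈ Set.Icc (0 : ℝ) 1)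
    {b x c u w : Y} (hu : IsPointAt t b x u) (hw : IsPointAt t b c w) :
    dist u w ≤ t * dist x c := by
  have h := hY.dist_sq_le_of_isPointAt ht hu hw
  rw [dist_self, dist_comm x b] at h
  refine le_of_sq_le_sq ?_ (mul_nonneg ht.1 dist_nonneg)
  linarith

/-- A weighted finite family of points in a complete `CAT(0)` space has a barycenter. -/
lemma IsCAT0.exists_barycenter [CompleteSpace Y] [Nonempty Y] (hY : IsCAT0 Y) {ι : Type*}
    [Fintype ι] {w : ι → ℝ} (hw : ∀ i, 0 < w i) (g : ι → Y) :
    ∃ b, ∀ y, ∑ i, w i * dist (g i) b ^ 2 ≤ ∑ i, w i * dist (g i) y ^ 2 := by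
  rcases isEmpty_or_nonempty ι with hι | hι
  · exact ⟨Classical.arbitrary Y, by simp⟩
  set φ : Y → ℝ := fun y => ∑ i, w i * dist (g i) y ^ 2 with hφ
  have hφ0 : ∀ y, 0 ≤ φ y := fun y =>
    Finset.sum_nonneg fun i _ => mul_nonneg (hw i).le (sq_nonneg _)
  have hbdd : BddBelow (Set.range φ) := ⟨0, by rintro _ ⟨y, rfl⟩; exact hφ0 y⟩
  set W := ∑ i, w i
  have hW : 0 < W := Finset.sum_pos (fun i _ => hw i) Finset.univ_nonempty
  -- uniform convexity of `φ`, tested at a midpoint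
  have hconv : ∀ y z, W * dist y z ^ 2 ≤ 2 * φ y + 2 * φ z - 4 * iInf φ := by
    intro y z
    obtain ⟨u, hu⟩ := hY.1.exists_isPointAt (t := 1 / 2) (by norm_num) y z
    have h1 : φ u ≤ 1 / 2 * φ y + 1 / 2 * φ z - 1 / 4 * (W * dist y z ^ 2) := by
      simp only [hφ, W, Finset.mul_sum, Finset.sum_mul, ← Finset.sum_add_distrib,
        ← Finset.sum_sub_distrib]
      refine Finset.sum_le_sum fun i _ => ?_
      have := mul_le_mul_of_nonneg_left (hY.dist_sq_le (by norm_num) hu (g i)) (hw i).le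
      linarith
    linarith [ciInf_le hbdd u]
  have hex : ∀ n : ℕ, ∃ y, φ y < iInf φ + 1 / ((n : ℝ) + 1) := fun n =>
    exists_lt_of_ciInf_lt (lt_add_of_pos_right _ (by positivity))
  choose y hy using hex
  have hcau : CauchySeq y := by
    refine cauchySeq_of_le_tendsto_0 (fun n : ℕ => √(4 / W * (1 / ((n : ℝ) + 1)))) ?_ ?_
    · intro n k N hn hk
      refine Real.le_sqrt_of_sq_le ?_
      rw [div_mul_eq_mul_div, le_div_iff₀ hW, mul_comm]
      have hmono : ∀ j : ℕ, N ≤ j → φ (y j) ≤ iInf φ + 1 / ((N : ℝ) + 1) := fun j hj =>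
        (hy j).le.trans (by gcongr)
      linarith [hconv (y n) (y k), hmono n hn, hmono k hk]
    · have := ((tendsto_one_div_add_atTop_nhds_zero_nat (𝕜 := ℝ)).const_mul (4 / W)).sqrt
      simpa using this
  obtain ⟨b, hb⟩ := cauchySeq_tendsto_of_complete hcau
  have hcont : Continuous φ := by fun_prop
  refine ⟨b, fun z => ?_⟩
  have hlim : φ b ≤ iInf φ + 0 :=
    le_of_tendsto_of_tendsto ((hcont.tendsto b).comp hb)
      (tendsto_one_div_add_atTop_nhds_zero_nat.const_add _)
      (Eventually.of_forall fun n => (hy n).le)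
  exact (hlim.trans_eq (add_zero _)).trans (ciInf_le hbdd z)

/-- A geodesic from `b` to `x`, parametrized on `[0, 1]`, as a geodesic issuing from `b`. -/
lemma IsGeodesicSpace.exists_geodesicFrom (hY : IsGeodesicSpace Y) (b x : Y) :
    ∃ v : GeodesicFrom b, ∀ t ∈ Set.Icc (0 : ℝ) 1, IsPointAt t b x (v.toFun t) := by
  obtain ⟨γ, h0, h1, h⟩ := hY b x
  refine ⟨⟨γ, h0, dist b x, dist_nonneg, 1, one_pos, h⟩, fun t ht => ⟨?_, ?_⟩⟩
  · have := h 0 (by simp) t ht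
    rwa [h0, zero_sub, abs_neg, abs_of_nonneg ht.1, mul_comm] at this
  · have := h t ht 1 (by simp)
    rwa [h1, abs_sub_comm, abs_of_nonneg (sub_nonneg.2 ht.2), mul_comm] at this

lemma IsCAT0.dist_geodesicFrom_le (hY : IsCAT0 Y) {b x x' : Y} {v v' : GeodesicFrom b}
    (hv : ∀ t ∈ Set.Icc (0 : ℝ) 1, IsPointAt t b x (v.toFun t))
    (hv' : ∀ t ∈ Set.Icc (0 : ℝ) 1, IsPointAt t b x' (v'.toFun t)) :
    dist v v' ≤ dist x x' := by
  refine limsup_le_of_le (GeodesicFrom.isBoundedUnder_ge v v').isCoboundedUnder_le ?_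
  filter_upwards [Ioo_mem_nhdsGT one_pos] with t ht
  have ht' : t ∈ Set.Icc (0 : ℝ) 1 := Set.Ioo_subset_Icc_self ht
  rw [GeodesicFrom.distQuot, div_le_iff₀ ht.1, mul_comm]
  exact hY.dist_le_mul ht' (hv t ht') (hv' t ht')

/-- If `b` is a barycenter of a family of points, then the points at parameter `t` on the geodesics
from `b` to the points of the family also have `b` as a barycenter: this is the triangle inequality
in `L²`. -/
lemma sum_le_sum_of_isPointAt {ι : Type*} [Fintype ι] {w : ι → ℝ} (hw : ∀ i, 0 < w i)
    {g u : ι → Y} {b : Y}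
    (hb : ∀ y, ∑ i, w i * dist (g i) b ^ 2 ≤ ∑ i, w i * dist (g i) y ^ 2)
    {t : ℝ} (ht : t ∈ Set.Icc (0 : ℝ) 1) (hu : ∀ i, IsPointAt t b (g i) (u i)) (y : Y) :
    t ^ 2 * ∑ i, w i * dist (g i) b ^ 2 ≤ ∑ i, w i * dist (u i) y ^ 2 := by
  have hpos : ∀ z : ι → ℝ, 0 ≤ ∑ i, w i * z i ^ 2 := fun z =>
    Finset.sum_nonneg fun i _ => mul_nonneg (hw i).le (sq_nonneg _)
  set A := ∑ i, w i * dist (g i) b ^ 2 with hA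
  set B := ∑ i, w i * dist (u i) y ^ 2 with hB
  set P := ∑ i, w i * (dist (g i) b * dist (u i) y) with hP
  have hA0 : 0 ≤ A := hpos _
  have hB0 : 0 ≤ B := hpos _
  have hP0 : 0 ≤ P := Finset.sum_nonneg fun i _ =>
    mul_nonneg (hw i).le (mul_nonneg dist_nonneg dist_nonneg)
  have hCS : P ^ 2 ≤ A * B := by
    have := Finset.sum_sq_le_sum_mul_sum_of_sq_le_mul Finset.univ
      (r := fun i => w i * (dist (g i) b * dist (u i) y))
      (f := fun i => w i * dist (g i) b ^ 2) (g := fun i => w i * dist (u i) y ^ 2)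
      (fun i _ => mul_nonneg (hw i).le (sq_nonneg _))
      (fun i _ => mul_nonneg (hw i).le (sq_nonneg _)) (fun i _ => le_of_eq (by ring))
    exact this
  have hle : A ≤ (1 - t) ^ 2 * A + 2 * (1 - t) * P + B := by
    refine (hb y).trans ?_
    simp only [hA, hB, hP, Finset.mul_sum, ← Finset.sum_add_distrib]
    refine Finset.sum_le_sum fun i _ => ?_
    have h1 : dist (g i) y ≤ (1 - t) * dist (g i) b + dist (u i) y := by
      have := dist_triangle (g i) (u i) y
      rwa [dist_comm (g i) (u i), (hu i).2, dist_comm b] at this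
    have h2 := mul_le_mul_of_nonneg_left (pow_le_pow_left₀ dist_nonneg h1 2) (hw i).le
    linarith
  -- with `√` the claim reads: `√A ≤ (1 - t) √A + √B` implies `t √A ≤ √B`
  have hPs : P ≤ √A * √B := by
    rw [← Real.sqrt_mul hA0]
    exact Real.le_sqrt_of_sq_le hCS
  have h1 : √A ≤ (1 - t) * √A + √B := by
    have h1t : 0 ≤ 1 - t := sub_nonneg.2 ht.2
    refine le_of_sq_le_sq ?_ (by positivity)
    have := mul_le_mul_of_nonneg_left hPs h1t
    nlinarith [Real.sq_sqrt hA0, Real.sq_sqrt hB0]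
  have h2 : t * √A ≤ √B := by linarith
  have h3 := pow_le_pow_left₀ (mul_nonneg ht.1 (Real.sqrt_nonneg _)) h2 2
  rwa [mul_pow, Real.sq_sqrt hA0, Real.sq_sqrt hB0] at h3

/-- If `b` is a barycenter of a family of points, then the apex of the tangent cone at `b` is a
barycenter of the initial vectors `v i` of the geodesics from `b` to these points. -/
lemma sum_le_sum_dist_geodesicFrom {ι : Type*} [Fintype ι] {w : ι → ℝ} (hw : ∀ i, 0 < w i)
    {g : ι → Y} {b : Y}
    (hb : ∀ y, ∑ i, w i * dist (g i) b ^ 2 ≤ ∑ i, w i * dist (g i) y ^ 2)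
    {v : ι → GeodesicFrom b}
    (hv : ∀ i, ∀ t ∈ Set.Icc (0 : ℝ) 1, IsPointAt t b (g i) ((v i).toFun t))
    (γ : GeodesicFrom b) :
    ∑ i, w i * dist (g i) b ^ 2 ≤ ∑ i, w i * dist (v i) γ ^ 2 := by
  have hev : ∀ ε : ℝ, 0 < ε →
      ∑ i, w i * dist (g i) b ^ 2 ≤ ∑ i, w i * (dist (v i) γ + ε) ^ 2 := by
    intro ε hε
    have h1 : ∀ᶠ t in 𝓝[>] (0 : ℝ), ∀ i,
        GeodesicFrom.distQuot (v i) γ t < dist (v i) γ + ε :=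
      eventually_all.2 fun i => eventually_lt_of_limsup_lt (lt_add_of_pos_right _ hε)
        (GeodesicFrom.isBoundedUnder_le _ _)
    obtain ⟨t, ht, ht01⟩ := (h1.and (Ioo_mem_nhdsGT one_pos)).exists
    have ht2 : 0 < t ^ 2 := pow_pos ht01.1 2
    have ht' : t ∈ Set.Icc (0 : ℝ) 1 := Set.Ioo_subset_Icc_self ht01
    have h2 := sum_le_sum_of_isPointAt hw hb ht' (fun i => hv i t ht') (γ.toFun t)
    refine le_of_mul_le_mul_left (h2.trans ?_) ht2
    rw [Finset.mul_sum]
    refine Finset.sum_le_sum fun i _ => ?_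
    have h3 := ht i
    rw [GeodesicFrom.distQuot, div_lt_iff₀ ht01.1] at h3
    have h4 := mul_le_mul_of_nonneg_left (pow_le_pow_left₀ dist_nonneg h3.le 2) (hw i).le
    linarith
  have hlim : Tendsto (fun ε : ℝ => ∑ i, w i * (dist (v i) γ + ε) ^ 2) (𝓝[>] 0)
      (𝓝 (∑ i, w i * (dist (v i) γ + 0) ^ 2)) := by
    refine tendsto_nhdsWithin_of_tendsto_nhds (Continuous.tendsto ?_ 0)
    fun_prop
  simp only [add_zero] at hlim
  exact ge_of_tendsto hlim (by filter_upwards [self_mem_nhdsWithin] with ε hε using hev ε hε)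

end CAT0

/-! ### From tangent cones to the space itself -/

/-- A lower bound for the spectrum with values in the tangent cone at a barycenter `b` of `g` bounds
the Rayleigh quotient of `g`. Passing from `g` to the initial vectors of the geodesics from `b`
does not increase the energy, and makes the apex a barycenter without changing the distances
to `b`. -/
lemma mul_mapDistSq_le_mapEnergy {V : Type*} [Fintype V] [DecidableEq V]
    {C : PreAbstractSimplicialComplex V} {m : Finset V → ℝ} (hm : ∀ σ ∈ C.faces, 0 < m σ)
    {Y : Type*} [MetricSpace Y] (hY : IsCAT0 Y) {l : ℝ} (hl0 : 0 ≤ l) {g : C.Vertex → Y} {b : Y}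
    (hb : IsBarycenter C m g b) (hl : (l : EReal) ≤ spectrumBottom C m (TangentCone b)) :
    l * mapDistSq C m g (fun _ => b) ≤ mapEnergy C m g := by
  classical
  have hE : 0 ≤ mapEnergy C m g := by
    refine mul_nonneg (by norm_num)
      (Finset.sum_nonneg fun c _ => Finset.sum_nonneg fun c' hc' => ?_)
    exact mul_nonneg (hm _ (Finset.mem_filter.1 hc').2.2).le (sq_nonneg _)
  have hw : ∀ c : C.Vertex, 0 < m {c.1} := fun c => hm _ c.2
  have hD : 0 ≤ mapDistSq C m g (fun _ => b) :=
    Finset.sum_nonneg fun c _ => mul_nonneg (hw c).le (sq_nonneg _)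
  rcases hD.eq_or_lt with h0 | h0
  · rwa [← h0, mul_zero]
  choose v hv using fun c => hY.1.exists_geodesicFrom b (g c)
  set g' : C.Vertex → TangentCone b := fun c => SeparationQuotient.mk (v c) with hg'
  have hbar : ∀ y : TangentCone b,
      mapDistSq C m g (fun _ => b) ≤ mapDistSq C m g' (fun _ => y) := by
    intro y
    obtain ⟨γ, rfl⟩ := SeparationQuotient.surjective_mk y
    exact sum_le_sum_dist_geodesicFrom hw hb hv γ
  have hEn : mapEnergy C m g' ≤ mapEnergy C m g := by
    refine mul_le_mul_of_nonneg_left (Finset.sum_le_sum fun c _ => Finset.sum_le_sum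
      fun c' hc' => ?_) (by norm_num)
    refine mul_le_mul_of_nonneg_left ?_ (hm _ (Finset.mem_filter.1 hc').2.2).le
    exact pow_le_pow_left₀ dist_nonneg (hY.dist_geodesicFrom_le (hv c) (hv c')) 2
  have hne : Nonempty C.Vertex := by
    by_contra hempty
    rw [not_nonempty_iff] at hempty
    simp [mapDistSq] at h0
  have hnc : ∃ c c', g' c ≠ g' c' := by
    by_contra hconst
    push Not at hconst
    have := hbar (g' hne.some)
    simp only [mapDistSq, hconst _ hne.some, dist_self] at this h0
    simp only [ne_eq, OfNat.ofNat_ne_zero, not_false_eq_true, zero_pow, mul_zero,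
      Finset.sum_const_zero] at this
    linarith
  have : Nonempty (TangentCone b) := ⟨g' hne.some⟩
  have hbd : mapDistSq C m g (fun _ => b) ≤ barDistSq C m g' := le_ciInf hbar
  have hRQ : (l : EReal) ≤ (rayleighQuot C m g' : ℝ) := hl.trans (iInf₂_le g' hnc)
  rw [EReal.coe_le_coe_iff, rayleighQuot] at hRQ
  calc l * mapDistSq C m g (fun _ => b) ≤ l * barDistSq C m g' := by gcongr
    _ ≤ mapEnergy C m g' := (le_div_iff₀ (h0.trans_le hbd)).1 hRQ
    _ ≤ mapEnergy C m g := hEn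

/-! ### Energy of sections of a flat bundle over a weighted complex -/

open Classical in
lemma sum_vertex {V : Type*} [Fintype V] (C : PreAbstractSimplicialComplex V) (F : V → ℝ) :
    ∑ c : C.Vertex, F c.1 = ∑ v, if {v} ∈ C.faces then F v else 0 := by
  rw [← Finset.sum_filter]
  exact (Finset.sum_subtype _ (by simp) F).symm

lemma singleton_mem_linkComplex {V : Type*} [DecidableEq V] {Z : PreAbstractSimplicialComplex V}
    {z v : V} : {v} ∈ (linkComplex Z z).faces ↔ z ≠ v ∧ {z, v} ∈ Z.faces := by
  simp [linkComplex]

open Classical in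
/-- The weight of the ordered pair `(v, w)`: that of the edge `{v, w}`, or `0` if this is not an
edge. -/
noncomputable def edgeWeight {V : Type*} [DecidableEq V] (Z : PreAbstractSimplicialComplex V)
    (m : Finset V → ℝ) (v w : V) : ℝ :=
  if v ≠ w ∧ {v, w} ∈ Z.faces then m {v, w} else 0

lemma edgeWeight_comm {V : Type*} [DecidableEq V] {Z : PreAbstractSimplicialComplex V}
    {m : Finset V → ℝ} (v w : V) : edgeWeight Z m v w = edgeWeight Z m w v := by
  unfold edgeWeight
  rw [Finset.pair_comm v w]
  congr 1
  rw [ne_comm]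

section Energy

variable {V : Type*} [Fintype V] [DecidableEq V]

/-- The weighted sum of `φ v w` over the ordered pairs of endpoints of an edge. -/
noncomputable def edgeSum (Z : PreAbstractSimplicialComplex V) (m : Finset V → ℝ)
    (φ : V → V → ℝ) : ℝ :=
  ∑ v, ∑ w, edgeWeight Z m v w * φ v w

variable {Z : PreAbstractSimplicialComplex V} {m : Finset V → ℝ}

lemma edgeWeight_nonneg (hm : IsWeight Z m) (v w : V) : 0 ≤ edgeWeight Z m v w := by
  unfold edgeWeight
  split_ifs with h
  exacts [(hm.pos _ h.2).le, le_rfl]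

lemma edgeSum_swap (φ : V → V → ℝ) : edgeSum Z m φ = edgeSum Z m fun v w => φ w v := by
  rw [edgeSum, Finset.sum_comm]
  simp only [edgeSum, edgeWeight_comm]

lemma edgeSum_add (φ ψ : V → V → ℝ) :
    edgeSum Z m (fun v w => φ v w + ψ v w) = edgeSum Z m φ + edgeSum Z m ψ := by
  simp only [edgeSum, mul_add, Finset.sum_add_distrib]

lemma edgeSum_const_mul (c : ℝ) (φ : V → V → ℝ) :
    edgeSum Z m (fun v w => c * φ v w) = c * edgeSum Z m φ := by
  simp only [edgeSum, Finset.mul_sum, mul_left_comm c]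

lemma edgeSum_mono (hm : IsWeight Z m) {φ ψ : V → V → ℝ}
    (h : ∀ v w, {v, w} ∈ Z.faces → φ v w ≤ ψ v w) : edgeSum Z m φ ≤ edgeSum Z m ψ := by
  refine Finset.sum_le_sum fun v _ => Finset.sum_le_sum fun w _ => ?_
  unfold edgeWeight
  split_ifs with hvw
  · exact mul_le_mul_of_nonneg_left (h v w hvw.2) (hm.pos _ hvw.2).le
  · simp

lemma edgeSum_congr {φ ψ : V → V → ℝ} (h : ∀ v w, {v, w} ∈ Z.faces → φ v w = ψ v w) :
    edgeSum Z m φ = edgeSum Z m ψ := by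
  refine Finset.sum_congr rfl fun v _ => Finset.sum_congr rfl fun w _ => ?_
  unfold edgeWeight
  split_ifs with hvw
  · rw [h v w hvw.2]
  · simp

lemma edgeSum_nonneg (hm : IsWeight Z m) {φ : V → V → ℝ} (h : ∀ v w, 0 ≤ φ v w) :
    0 ≤ edgeSum Z m φ :=
  Finset.sum_nonneg fun v _ => Finset.sum_nonneg fun w _ =>
    mul_nonneg (edgeWeight_nonneg hm v w) (h v w)

lemma mul_le_edgeSum (hm : IsWeight Z m) {φ : V → V → ℝ} (h : ∀ v w, 0 ≤ φ v w) {v w : V}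
    (hne : v ≠ w) (hvw : {v, w} ∈ Z.faces) : m {v, w} * φ v w ≤ edgeSum Z m φ := by
  have h0 : ∀ v w, 0 ≤ edgeWeight Z m v w * φ v w := fun v w =>
    mul_nonneg (edgeWeight_nonneg hm v w) (h v w)
  calc m {v, w} * φ v w = edgeWeight Z m v w * φ v w := by rw [edgeWeight, if_pos ⟨hne, hvw⟩]
    _ ≤ ∑ w, edgeWeight Z m v w * φ v w :=
      Finset.single_le_sum (f := fun w => edgeWeight Z m v w * φ v w) (fun w _ => h0 v w)
        (Finset.mem_univ w)
    _ ≤ edgeSum Z m φ :=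
      Finset.single_le_sum (f := fun v => ∑ w, edgeWeight Z m v w * φ v w)
        (fun v _ => Finset.sum_nonneg fun w _ => h0 v w) (Finset.mem_univ v)

/-- Equality holds unless `σ` is a maximal simplex. -/
lemma IsWeight.sum_insert_le (hm : IsWeight Z m) {σ : Finset V} (hσ : σ ∈ Z.faces)
    [DecidablePred fun z => z ∉ σ ∧ insert z σ ∈ Z.faces] :
    ∑ z with z ∉ σ ∧ insert z σ ∈ Z.faces, m (insert z σ) ≤ m σ := by
  classical
  by_cases hmax : ∃ τ ∈ Z.faces, σ ⊂ τ
  · rw [hm.sum_cofaces σ hσ hmax]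
    rw [← Finset.sum_image (f := m) (g := fun z => insert z σ)]
    · refine Finset.sum_le_sum_of_subset_of_nonneg ?_ ?_
      · intro τ hτ
        obtain ⟨z, hz, rfl⟩ := Finset.mem_image.1 hτ
        have hz := (Finset.mem_filter.1 hz).2
        simp [hz.2, hz.1]
      · intro τ hτ _
        exact (hm.pos τ (Finset.mem_filter.1 hτ).2.1).le
    · intro z hz z' hz' h
      have hz := (Finset.mem_filter.1 hz).2
      have : z ∈ insert z' σ := h.subset (Finset.mem_insert_self z σ)
      exact (Finset.mem_insert.1 this).resolve_right hz.1
  · rw [Finset.filter_false_of_mem, Finset.sum_empty]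
    · exact (hm.pos σ hσ).le
    · rintro z - ⟨hz, hz'⟩
      exact hmax ⟨_, hz', Finset.ssubset_insert hz⟩

lemma mapDistSq_link {Y : Type*} [MetricSpace Y] (z : V) (g : V → Y) (b : Y) :
    mapDistSq (linkComplex Z z) (linkWeight m z) (fun c => g c.1) (fun _ => b)
      = ∑ w, edgeWeight Z m z w * dist (g w) b ^ 2 := by
  classical
  rw [mapDistSq, sum_vertex (linkComplex Z z) fun v => linkWeight m z {v} * dist (g v) b ^ 2]
  simp only [singleton_mem_linkComplex, edgeWeight, linkWeight, ite_mul, zero_mul]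

/-- The energies of the restrictions to the links add up to at most the energy of the map, since an
edge `{v, w}` is counted with the weights of the triangles that contain it. -/
lemma sum_mapEnergy_link_le (hm : IsWeight Z m) {Y : Type*} [MetricSpace Y] (g : V → V → Y)
    {φ : V → V → ℝ} (hφ : ∀ v w, 0 ≤ φ v w)
    (hg : ∀ z v w, insert z {v, w} ∈ Z.faces → dist (g z v) (g z w) ^ 2 = φ v w) :
    ∑ z, mapEnergy (linkComplex Z z) (linkWeight m z) (fun c => g z c.1)
      ≤ 1 / 2 * edgeSum Z m φ := by
  classical
  have hz : ∀ z, mapEnergy (linkComplex Z z) (linkWeight m z) (fun c => g z c.1) ≤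
      1 / 2 * ∑ v, ∑ w, if v ≠ w ∧ (z ∉ ({v, w} : Finset V) ∧ insert z {v, w} ∈ Z.faces)
        then m (insert z {v, w}) * φ v w else 0 := by
    intro z
    have hnn : ∀ v w, 0 ≤ if v ≠ w ∧ (z ∉ ({v, w} : Finset V) ∧ insert z {v, w} ∈ Z.faces)
        then m (insert z {v, w}) * φ v w else 0 := by
      intro v w
      split_ifs with h
      exacts [mul_nonneg (hm.pos _ h.2.2).le (hφ v w), le_rfl]
    rw [mapEnergy]
    refine mul_le_mul_of_nonneg_left ?_ (by norm_num)
    have h1 : ∀ c : (linkComplex Z z).Vertex,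
        (∑ c' : (linkComplex Z z).Vertex with c ≠ c' ∧ {c.1, c'.1} ∈ (linkComplex Z z).faces,
          linkWeight m z {c.1, c'.1} * dist (g z c.1) (g z c'.1) ^ 2)
        ≤ ∑ w, if c.1 ≠ w ∧ (z ∉ ({c.1, w} : Finset V) ∧ insert z {c.1, w} ∈ Z.faces)
          then m (insert z {c.1, w}) * φ c.1 w else 0 := by
      intro c
      rw [Finset.sum_filter]
      refine le_trans (le_of_eq ?_) ((sum_vertex (linkComplex Z z) fun w =>
        if c.1 ≠ w ∧ (z ∉ ({c.1, w} : Finset V) ∧ insert z {c.1, w} ∈ Z.faces)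
          then m (insert z {c.1, w}) * φ c.1 w else 0).le.trans ?_)
      · refine Finset.sum_congr rfl fun c' _ => ?_
        have hiff : (c ≠ c' ∧ {c.1, c'.1} ∈ (linkComplex Z z).faces) ↔
            (c.1 ≠ c'.1 ∧ (z ∉ ({c.1, c'.1} : Finset V) ∧ insert z {c.1, c'.1} ∈ Z.faces)) := by
          rw [Ne, Subtype.ext_iff]
          exact and_congr_right fun _ => ⟨fun h => h.2, fun h => ⟨by simp, h⟩⟩
        by_cases hc : c ≠ c' ∧ {c.1, c'.1} ∈ (linkComplex Z z).faces
        · rw [if_pos hc, if_pos (hiff.1 hc), hg z _ _ (hiff.1 hc).2.2]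
          rfl
        · rw [if_neg hc, if_neg (mt hiff.2 hc)]
      · refine Finset.sum_le_sum fun w _ => ?_
        by_cases h : {w} ∈ (linkComplex Z z).faces
        · rw [if_pos h]
        · rw [if_neg h]
          exact hnn _ _
    refine (Finset.sum_le_sum fun c _ => h1 c).trans ((sum_vertex (linkComplex Z z) fun v =>
      ∑ w, if v ≠ w ∧ (z ∉ ({v, w} : Finset V) ∧ insert z {v, w} ∈ Z.faces)
        then m (insert z {v, w}) * φ v w else 0).le.trans ?_)
    refine Finset.sum_le_sum fun v _ => ?_
    split_ifs
    exacts [le_rfl, Finset.sum_nonneg fun w _ => hnn v w]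
  refine (Finset.sum_le_sum fun z _ => hz z).trans ?_
  rw [← Finset.mul_sum]
  refine mul_le_mul_of_nonneg_left ?_ (by norm_num)
  rw [Finset.sum_comm]
  refine Finset.sum_le_sum fun v _ => ?_
  rw [Finset.sum_comm]
  refine Finset.sum_le_sum fun w _ => ?_
  rw [← Finset.sum_filter]
  by_cases hvw : v ≠ w ∧ {v, w} ∈ Z.faces
  · rw [edgeWeight, if_pos hvw, ← Finset.sum_mul]
    refine mul_le_mul_of_nonneg_right ?_ (hφ v w)
    simpa only [hvw.1, ne_eq, not_false_eq_true, true_and] using hm.sum_insert_le hvw.2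
  · rw [edgeWeight, if_neg hvw, zero_mul, Finset.filter_false_of_mem, Finset.sum_empty]
    rintro z - ⟨h1, -, h2⟩
    exact hvw ⟨h1, (Z.isRelLowerSet_faces h2).2 (Finset.subset_insert _ _) (by simp)⟩

end Energy

/-! ### Energy decay and flat sections -/

/-- `h v w` is the transport from the fiber over `w` to the fiber over `v` in a bundle over the
vertices of `Z`; it is flat when transport around the boundary of every simplex is trivial. -/
def IsFlat {V G : Type*} [Mul G] (Z : PreAbstractSimplicialComplex V) (h : V → V → G) : Prop :=
  ∀ σ ∈ Z.faces, ∀ u ∈ σ, ∀ v ∈ σ, ∀ w ∈ σ, h u v * h v w = h u w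

/-- The squared length of the edge `{v, w}` for the section `f` of the bundle defined by `h`. -/
def edgeDistSq {V Y : Type*} [MetricSpace Y] (h : V → V → Y ≃ᵢ Y) (f : V → Y) (v w : V) : ℝ :=
  dist (f v) (h v w (f w)) ^ 2

/-- A nonnegative continuous function on a complete space has a zero, if each point can be moved so
that the function decreases by a fixed factor, by a distance controlled by the square root of the
function. -/
lemma exists_zero_of_contracting {X : Type*} [MetricSpace X] [CompleteSpace X] [Nonempty X]
    {φ : X → ℝ} (hφ : Continuous φ) (h0 : ∀ x, 0 ≤ φ x) {r K : ℝ} (hr0 : 0 ≤ r) (hr : r < 1)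
    (hK : 0 ≤ K) (hstep : ∀ x, ∃ y, φ y ≤ r * φ x ∧ dist x y ^ 2 ≤ K * φ x) :
    ∃ x, φ x = 0 := by
  choose F hF1 hF2 using hstep
  let x : ℕ → X := fun n => F^[n] (Classical.arbitrary X)
  have hx : ∀ n, x (n + 1) = F (x n) := fun n => Function.iterate_succ_apply' F n _
  have hdecay : ∀ n, φ (x n) ≤ r ^ n * φ (x 0) := by
    intro n
    induction n with
    | zero => simp
    | succ n ih =>
      rw [hx, pow_succ', mul_assoc]
      exact (hF1 _).trans (mul_le_mul_of_nonneg_left ih hr0)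
  have hsq : √r < 1 := by rwa [Real.sqrt_lt' one_pos, one_pow]
  have hcau : CauchySeq x := by
    refine cauchySeq_of_le_geometric (√r) √(K * φ (x 0)) hsq fun n => ?_
    rw [hx]
    refine le_of_sq_le_sq ?_ (by positivity)
    rw [mul_pow, Real.sq_sqrt (mul_nonneg hK (h0 _)), ← pow_mul, mul_comm n 2, pow_mul,
      Real.sq_sqrt hr0]
    calc dist (x n) (F (x n)) ^ 2 ≤ K * φ (x n) := hF2 _
      _ ≤ K * (r ^ n * φ (x 0)) := mul_le_mul_of_nonneg_left (hdecay n) hK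
      _ = K * φ (x 0) * r ^ n := by ring
  obtain ⟨y, hy⟩ := cauchySeq_tendsto_of_complete hcau
  refine ⟨y, le_antisymm ?_ (h0 y)⟩
  have hlim : Tendsto (fun n => r ^ n * φ (x 0)) atTop (𝓝 (0 * φ (x 0))) :=
    (tendsto_pow_atTop_nhds_zero_of_lt_one hr0 hr).mul_const _
  rw [zero_mul] at hlim
  exact le_of_tendsto_of_tendsto ((hφ.tendsto y).comp hy) hlim (Eventually.of_forall hdecay)

section Decay

variable {V : Type*} [Fintype V] [DecidableEq V] {Z : PreAbstractSimplicialComplex V}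
  {m : Finset V → ℝ} {Y : Type*} [MetricSpace Y]

/-- Every section `f` has a section `F` of barycenters: `F z` is a barycenter of the values of `f`
on the link of `z`, transported to the fiber over `z`. The spectral condition bounds the total
squared distance between the values of `f` and the neighboring values of `F`. -/
lemma exists_barycenter_section [CompleteSpace Y] [Nonempty Y] (hm : IsWeight Z m) (hY : IsCAT0 Y)
    {l : ℝ} (hl0 : 0 ≤ l)
    (hl : ∀ (z : V) (y : Y),
      (l : EReal) ≤ spectrumBottom (linkComplex Z z) (linkWeight m z) (TangentCone y))
    {h : V → V → Y ≃ᵢ Y} (hh : IsFlat Z h) (f : V → Y) :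
    ∃ F : V → Y, (∀ v, (∀ w, v ≠ w → {v, w} ∉ Z.faces) → F v = f v) ∧
      l * edgeSum Z m (fun v w => dist (F v) (h v w (f w)) ^ 2)
        ≤ 1 / 2 * edgeSum Z m (edgeDistSq h f) := by
  classical
  have hpos : ∀ z, ∀ σ ∈ (linkComplex Z z).faces, 0 < linkWeight m z σ := fun z σ hσ =>
    hm.pos _ hσ.2.2
  have hex : ∀ z, ∃ b, ((∀ w, z ≠ w → {z, w} ∉ Z.faces) → b = f z) ∧
      IsBarycenter (linkComplex Z z) (linkWeight m z) (fun c => h z c.1 (f c.1)) b := by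
    intro z
    by_cases hz : ∀ w, z ≠ w → {z, w} ∉ Z.faces
    · refine ⟨f z, fun _ => rfl, fun y => le_of_eq ?_⟩
      refine (Finset.sum_eq_zero ?_).trans (Finset.sum_eq_zero ?_).symm <;>
      · intro c _
        have hc := singleton_mem_linkComplex.1 c.2
        exact absurd hc.2 (hz _ hc.1)
    · obtain ⟨b, hb⟩ := hY.exists_barycenter
        (w := fun c : (linkComplex Z z).Vertex => linkWeight m z {c.1})
        (fun c => hpos z _ c.2) (fun c => h z c.1 (f c.1))
      exact ⟨b, fun h => absurd h hz, hb⟩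
  choose F hF1 hF2 using hex
  refine ⟨F, hF1, ?_⟩
  have hlink : ∀ z, l * ∑ w, edgeWeight Z m z w * dist (F z) (h z w (f w)) ^ 2
      ≤ mapEnergy (linkComplex Z z) (linkWeight m z) (fun c => h z c.1 (f c.1)) := by
    intro z
    have := mul_mapDistSq_le_mapEnergy (hpos z) hY hl0 (hF2 z) (hl z (F z))
    rw [mapDistSq_link z fun w => h z w (f w)] at this
    simpa only [dist_comm (F z)] using this
  rw [edgeSum, Finset.mul_sum]
  refine (Finset.sum_le_sum fun z _ => hlink z).trans ?_
  refine sum_mapEnergy_link_le hm (fun z v => h z v (f v)) (fun v w => sq_nonneg _) ?_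
  intro z v w hzvw
  rw [edgeDistSq, ← (h z v).dist_eq (f v), ← IsometryEquiv.mul_apply,
    hh _ hzvw z (by simp) v (by simp) w (by simp)]

/-- Moving a section towards its section of barycenters by a small fixed proportion decreases the
energy by a definite factor. -/
lemma exists_decay [CompleteSpace Y] [Nonempty Y] (hm : IsWeight Z m) (hY : IsCAT0 Y)
    {l : ℝ} (hl2 : 1 / 2 < l)
    (hl : ∀ (z : V) (y : Y),
      (l : EReal) ≤ spectrumBottom (linkComplex Z z) (linkWeight m z) (TangentCone y))
    {h : V → V → Y ≃ᵢ Y} (hh : IsFlat Z h) :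
    ∃ r K : ℝ, 0 ≤ r ∧ r < 1 ∧ 0 ≤ K ∧ ∀ f : V → Y, ∃ f' : V → Y,
      edgeSum Z m (edgeDistSq h f') ≤ r * edgeSum Z m (edgeDistSq h f) ∧
      dist f f' ^ 2 ≤ K * edgeSum Z m (edgeDistSq h f) := by
  obtain ⟨μ, hμ0, hμ⟩ : ∃ μ : ℝ, 0 < μ ∧ ∀ σ ∈ Z.faces, μ ≤ m σ := by
    rcases Z.faces.eq_empty_or_nonempty with he | he
    · exact ⟨1, one_pos, by simp [he]⟩
    · obtain ⟨σ, hσ, hmin⟩ := Set.exists_min_image Z.faces m (Set.toFinite _) he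
      exact ⟨m σ, hm.pos σ hσ, hmin⟩
  have hl0 : 0 < l := by linarith
  set δ : ℝ := 2 - 1 / l with hδ
  have hδ0 : 0 < δ := by
    rw [hδ, sub_pos, div_lt_iff₀ hl0]
    linarith
  have hδ2 : δ ≤ 2 := by
    rw [hδ]
    linarith [one_div_pos.2 hl0]
  -- the factor `(1 - t) ^ 2 + t * (1 - t) / l + 10 * t ^ 2` below is at most `1 - δ * t / 2`
  set t : ℝ := δ / 22 with ht
  clear_value t
  have ht01 : t ∈ Set.Icc (0 : ℝ) 1 := ⟨by rw [ht]; positivity, by rw [ht]; linarith⟩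
  refine ⟨1 - δ ^ 2 / 44, 4 / μ, by nlinarith, by nlinarith, by positivity, fun f => ?_⟩
  obtain ⟨F, hF1, hF2⟩ := exists_barycenter_section hm hY hl0.le hl hh f
  have hinv : ∀ v w, {v, w} ∈ Z.faces → ∀ y, h v w (h w v y) = y := by
    intro v w hvw y
    rw [← IsometryEquiv.mul_apply, hh _ hvw v (by simp) w (by simp) v (by simp)]
    have h1 : h v v = 1 :=
      mul_eq_left.1 (hh _ hvw v (by simp) v (by simp) v (by simp))
    rw [h1, IsometryEquiv.coe_one, id]
  have hsymm : ∀ v w, {v, w} ∈ Z.faces → ∀ y y', dist y (h v w y') = dist (h w v y) y' := by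
    intro v w hvw y y'
    rw [← (h v w).dist_eq (h w v y) y', hinv v w hvw]
  set e := edgeSum Z m (edgeDistSq h f) with he
  set Q := edgeSum Z m (fun v w => dist (F v) (h v w (f w)) ^ 2) with hQ
  set D := edgeSum Z m (fun v _ => dist (f v) (F v) ^ 2) with hD
  set e₁ := edgeSum Z m (edgeDistSq h F) with he₁
  have he0 : 0 ≤ e := edgeSum_nonneg hm fun v w => sq_nonneg _
  have hQ' : edgeSum Z m (fun v w => dist (f v) (h v w (F w)) ^ 2) = Q := by
    rw [hQ, edgeSum_swap]
    refine edgeSum_congr fun v w hvw => ?_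
    rw [hsymm w v (by rwa [Finset.pair_comm]), dist_comm]
  have hD' : edgeSum Z m (fun v w => dist (h v w (f w)) (h v w (F w)) ^ 2) = D := by
    rw [hD, edgeSum_swap]
    simp only [IsometryEquiv.dist_eq]
  have hQe : Q ≤ 1 / l / 2 * e := by
    have : Q ≤ (1 / 2 * e) / l := by rw [le_div_iff₀ hl0]; linarith
    refine this.trans_eq (by ring)
  have hsq : ∀ x y z : Y, dist x z ^ 2 ≤ 2 * dist x y ^ 2 + 2 * dist y z ^ 2 := by
    intro x y z
    have := pow_le_pow_left₀ dist_nonneg (dist_triangle x y z) 2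
    nlinarith [sq_nonneg (dist x y - dist y z)]
  have hQ1 : Q ≤ e := hQe.trans (by nlinarith)
  have hDe : D ≤ 4 * e := by
    have : D ≤ 2 * e + 2 * Q := by
      rw [hD, he, hQ, ← edgeSum_const_mul, ← edgeSum_const_mul, ← edgeSum_add]
      refine edgeSum_mono hm fun v w _ => ?_
      rw [edgeDistSq, dist_comm (F v)]
      exact hsq _ _ _
    linarith
  have he₁e : e₁ ≤ 10 * e := by
    have : e₁ ≤ 2 * Q + 2 * D := by
      rw [he₁, hQ, ← hD', ← edgeSum_const_mul, ← edgeSum_const_mul, ← edgeSum_add]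
      exact edgeSum_mono hm fun v w _ => hsq _ _ _
    linarith
  choose f' hf' using fun v => hY.1.exists_isPointAt ht01 (f v) (F v)
  refine ⟨f', ?_, ?_⟩
  · have hmain : edgeSum Z m (edgeDistSq h f')
        ≤ (1 - t) ^ 2 * e + t * (1 - t) * (Q + Q) + t ^ 2 * e₁ := by
      nth_rewrite 2 [← hQ']
      rw [he, hQ, he₁, ← edgeSum_add, ← edgeSum_const_mul, ← edgeSum_const_mul,
        ← edgeSum_const_mul, ← edgeSum_add, ← edgeSum_add]
      refine edgeSum_mono hm fun v w _ => ?_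
      simp only [edgeDistSq]
      have h1 := hY.dist_sq_le_of_isPointAt ht01 (hf' v) ((hf' w).map (h v w))
      have h2 : 0 ≤ t * (1 - t) * (dist (f v) (F v) ^ 2
          + dist (h v w (f w)) (h v w (F w)) ^ 2) :=
        mul_nonneg (mul_nonneg ht01.1 (sub_nonneg.2 ht01.2)) (by positivity)
      exact h1.trans (by linarith)
    have h1 : t * (1 - t) * (Q + Q) ≤ t * (1 - t) * (1 / l * e) :=
      mul_le_mul_of_nonneg_left (by linarith) (mul_nonneg ht01.1 (sub_nonneg.2 ht01.2))
    have h2 : t ^ 2 * e₁ ≤ t ^ 2 * (10 * e) := mul_le_mul_of_nonneg_left he₁e (sq_nonneg t)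
    have h3 : (1 - t) ^ 2 + t * (1 - t) * (1 / l) + 10 * t ^ 2 ≤ 1 - δ ^ 2 / 44 := by
      have : 1 / l = 2 - δ := by rw [hδ]; ring
      rw [this, ht]
      nlinarith [mul_nonneg (sq_nonneg δ) (sub_nonneg.2 hδ2)]
    have h4 := mul_le_mul_of_nonneg_right h3 he0
    linarith
  · have hKe : 0 ≤ 4 / μ * e := by positivity
    have hv : ∀ v, dist (f v) (f' v) ≤ √(4 / μ * e) := by
      intro v
      refine Real.le_sqrt_of_sq_le ?_
      rw [(hf' v).1]
      by_cases hiso : ∀ w, v ≠ w → {v, w} ∉ Z.faces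
      · rw [hF1 v hiso, dist_self, mul_zero]
        simpa using hKe
      · push Not at hiso
        obtain ⟨w, hne, hvw⟩ := hiso
        have h1 := mul_le_edgeSum hm (φ := fun v _ => dist (f v) (F v) ^ 2)
          (fun v w => sq_nonneg _) hne hvw
        have h2 : μ * dist (f v) (F v) ^ 2 ≤ 4 * e :=
          (mul_le_mul_of_nonneg_right (hμ _ hvw) (sq_nonneg _)).trans (h1.trans hDe)
        rw [div_mul_eq_mul_div, le_div_iff₀ hμ0, mul_pow]
        have h3 : t ^ 2 ≤ 1 := pow_le_one₀ ht01.1 ht01.2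
        nlinarith [mul_nonneg hμ0.le (sq_nonneg (dist (f v) (F v)))]
    have := (dist_pi_le_iff (Real.sqrt_nonneg _)).2 hv
    calc dist f f' ^ 2 ≤ √(4 / μ * e) ^ 2 := pow_le_pow_left₀ dist_nonneg this 2
      _ = 4 / μ * e := Real.sq_sqrt hKe

/-- Under the spectral condition a flat bundle with fiber `Y` over `Z` has a flat section. -/
lemma exists_flat_section [CompleteSpace Y] [Nonempty Y] (hm : IsWeight Z m) (hY : IsCAT0 Y)
    {l : ℝ} (hl2 : 1 / 2 < l)
    (hl : ∀ (z : V) (y : Y),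
      (l : EReal) ≤ spectrumBottom (linkComplex Z z) (linkWeight m z) (TangentCone y))
    {h : V → V → Y ≃ᵢ Y} (hh : IsFlat Z h) :
    ∃ f : V → Y, ∀ v w, {v, w} ∈ Z.faces → f v = h v w (f w) := by
  obtain ⟨r, K, hr0, hr, hK, hstep⟩ := exists_decay hm hY hl2 hl hh
  have hcont : Continuous fun f : V → Y => edgeSum Z m (edgeDistSq h f) := by
    have (v w : V) : Continuous fun f : V → Y => h v w (f w) :=
      (h v w).continuous.comp (continuous_apply w)
    unfold edgeSum edgeDistSq
    fun_prop
  obtain ⟨f, hf⟩ := exists_zero_of_contracting hcont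
    (fun f => edgeSum_nonneg hm fun v w => sq_nonneg _) hr0 hr hK hstep
  refine ⟨f, fun v w hvw => ?_⟩
  rcases eq_or_ne v w with rfl | hne
  · have h1 : h v v = 1 := mul_eq_left.1 (hh _ hvw v (by simp) v (by simp) v (by simp))
    rw [h1, IsometryEquiv.coe_one, id]
  · have h1 := mul_le_edgeSum hm (φ := edgeDistSq h f) (fun v w => sq_nonneg _) hne hvw
    rw [hf] at h1
    have h2 : edgeDistSq h f v w ≤ 0 := nonpos_of_mul_nonpos_right h1 (hm.pos _ hvw)
    exact dist_eq_zero.1 (pow_eq_zero_iff two_ne_zero |>.1 (le_antisymm h2 (sq_nonneg _)))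

end Decay

/-! ### Holonomy along paths -/

section Holonomy

variable {X : Type*} [TopologicalSpace X] {G : Type*} [Group G] {x₀ : X}

open Classical in
/-- The extension to all paths of a homomorphism `ρ` defined on the fundamental group at `x₀`:
endpoints of paths are joined to `x₀` by chosen paths, and paths outside the path component of `x₀`
act trivially. -/
noncomputable def holonomy (ρ : FundamentalGroup X x₀ →* G) {a b : X} (p : Path a b) : G :=
  if h : Joined x₀ a then
    ρ (Path.Homotopic.Quotient.mk
      ((h.somePath.trans p).trans (h.trans ⟨p⟩ : Joined x₀ b).somePath.symm))
  else 1

lemma holonomy_congr (ρ : FundamentalGroup X x₀ →* G) {a b : X} {p q : Path a b}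
    (hpq : p.Homotopic q) : holonomy ρ p = holonomy ρ q := by
  unfold holonomy
  split_ifs with h
  · congr 1
    exact Path.Homotopic.Quotient.eq.2
      (((Path.Homotopic.refl _).hcomp hpq).hcomp (Path.Homotopic.refl _))
  · rfl

lemma holonomy_trans (ρ : FundamentalGroup X x₀ →* G) {a b c : X} (p : Path a b) (q : Path b c) :
    holonomy ρ (p.trans q) = holonomy ρ q * holonomy ρ p := by
  unfold holonomy
  by_cases h : Joined x₀ a
  · have hb : Joined x₀ b := h.trans ⟨p⟩
    rw [dif_pos h, dif_pos h, dif_pos hb, ← map_mul, FundamentalGroup.mul_def]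
    congr 1
    simp only [Path.Homotopic.Quotient.mk_trans, Path.Homotopic.Quotient.mk_symm,
      Path.Homotopic.Quotient.trans_assoc]
    rw [← Path.Homotopic.Quotient.trans_assoc (Path.Homotopic.Quotient.symm _) _ _,
      Path.Homotopic.Quotient.symm_trans, Path.Homotopic.Quotient.refl_trans]
  · have hb : ¬ Joined x₀ b := fun hb => h (hb.trans ⟨p.symm⟩)
    rw [dif_neg h, dif_neg h, dif_neg hb, mul_one]

lemma exists_holonomy_eq (ρ : FundamentalGroup X x₀ →* G) (γ : FundamentalGroup X x₀) :
    ∃ p : Path x₀ x₀, holonomy ρ p = ρ γ := by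
  obtain ⟨q, rfl⟩ := Path.Homotopic.Quotient.mk_surjective γ
  have h : Joined x₀ x₀ := Joined.refl x₀
  refine ⟨(h.somePath.symm.trans q).trans h.somePath, ?_⟩
  rw [holonomy, dif_pos h]
  congr 1
  simp only [Path.Homotopic.Quotient.mk_trans, Path.Homotopic.Quotient.mk_symm,
    Path.Homotopic.Quotient.trans_assoc, Path.Homotopic.Quotient.trans_symm,
    Path.Homotopic.Quotient.trans_refl]
  rw [← Path.Homotopic.Quotient.trans_assoc, Path.Homotopic.Quotient.trans_symm,
    Path.Homotopic.Quotient.refl_trans]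

end Holonomy

/-! ### Paths in the geometric realization -/

lemma Path.homotopic_of_forall_mem {E : Type*} [TopologicalSpace E] {R S : Set E} (hSR : S ⊆ R)
    [SimplyConnectedSpace S] {a b : R} (p q : Path a b) (hp : ∀ t, (p t : E) ∈ S)
    (hq : ∀ t, (q t : E) ∈ S) : p.Homotopic q := by
  have ha : (a : E) ∈ S := by simpa using hp 0
  have hb : (b : E) ∈ S := by simpa using hp 1
  let lift (r : Path a b) (hr : ∀ t, (r t : E) ∈ S) : Path (⟨a, ha⟩ : S) ⟨b, hb⟩ :=
    { toFun := fun t => ⟨r t, hr t⟩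
      continuous_toFun := by fun_prop
      source' := by simp
      target' := by simp }
  exact (SimplyConnectedSpace.paths_homotopic (lift p hp) (lift q hq)).map
    ⟨Set.inclusion hSR, continuous_inclusion hSR⟩

lemma faces_of_subset {V : Type*} {Z : PreAbstractSimplicialComplex V} {σ τ : Finset V}
    (hσ : σ ∈ Z.faces) (h : τ ⊆ σ) (hτ : τ.Nonempty) : τ ∈ Z.faces :=
  (Z.isRelLowerSet_faces hσ).2 h hτ

section Realization

variable {V : Type*} [Fintype V]

open Classical in
/-- The vertices with a nonzero coordinate, that is, for a point of a geometric realization, the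
smallest simplex that contains it. -/
noncomputable def carrier (p : V → ℝ) : Finset V := Finset.univ.filter fun v => p v ≠ 0

lemma mem_carrier {p : V → ℝ} {v : V} : v ∈ carrier p ↔ p v ≠ 0 := by
  simp [carrier]

lemma carrier_nonempty {p : V → ℝ} (hp : p ∈ stdSimplex ℝ V) : (carrier p).Nonempty := by
  by_contra h
  rw [Finset.not_nonempty_iff_eq_empty, Finset.eq_empty_iff_forall_notMem] at h
  have h0 : ∀ v, p v = 0 := fun v => by simpa [mem_carrier] using h v
  have := hp.2
  simp [h0] at this

lemma carrier_mem_faces {Z : PreAbstractSimplicialComplex V} (p : geomRealization Z) :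
    carrier p.1 ∈ Z.faces := p.2.2

variable [DecidableEq V] (Z : PreAbstractSimplicialComplex V)

/-- The closed star of the vertex `v`. -/
def closedStar (v : V) : Set (V → ℝ) :=
  {p | p ∈ stdSimplex ℝ V ∧ insert v (carrier p) ∈ Z.faces}

variable {Z}

lemma closedStar_subset (v : V) : closedStar Z v ⊆ geomRealization Z := fun _ hp =>
  ⟨hp.1, faces_of_subset hp.2 (Finset.subset_insert _ _) (carrier_nonempty hp.1)⟩

lemma carrier_single (v : V) : carrier (Pi.single v (1 : ℝ)) = {v} := by
  ext w
  rw [mem_carrier, Finset.mem_singleton]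
  by_cases h : w = v <;> simp [h]

lemma carrier_combination_subset (p q : V → ℝ) (a b : ℝ) :
    carrier (a • p + b • q) ⊆ carrier p ∪ carrier q := by
  intro v hv
  rw [mem_carrier] at hv
  rw [Finset.mem_union, mem_carrier, mem_carrier]
  by_contra! h
  simp [h.1, h.2] at hv

lemma starConvex_closedStar (v : V) : StarConvex ℝ (Pi.single v 1) (closedStar Z v) := by
  intro p hp a b ha hb hab
  refine ⟨convex_stdSimplex ℝ V (single_mem_stdSimplex ℝ v) hp.1 ha hb hab,
    faces_of_subset hp.2 (Finset.insert_subset (Finset.mem_insert_self _ _) ?_) (by simp)⟩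
  refine (carrier_combination_subset _ _ a b).trans ?_
  rw [carrier_single]
  exact (Finset.insert_eq v _).superset

lemma homotopic_of_mem_closedStar {v : V} {a b : geomRealization Z} (p q : Path a b)
    (hp : ∀ t, (p t : V → ℝ) ∈ closedStar Z v) (hq : ∀ t, (q t : V → ℝ) ∈ closedStar Z v) :
    p.Homotopic q := by
  have : ContractibleSpace (closedStar Z v) :=
    (starConvex_closedStar v).contractibleSpace ⟨_, hp 0⟩
  exact Path.homotopic_of_forall_mem (closedStar_subset v) p q hp hq

/-- The straight path between two points of a common simplex. -/
noncomputable def straightPath (a b : geomRealization Z)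
    (h : carrier a.1 ∪ carrier b.1 ∈ Z.faces) : Path a b where
  toFun t := ⟨(1 - t : ℝ) • a.1 + (t : ℝ) • b.1, by
    have hs : (1 - t : ℝ) • a.1 + (t : ℝ) • b.1 ∈ stdSimplex ℝ V :=
      convex_stdSimplex ℝ V a.2.1 b.2.1 (sub_nonneg.2 t.2.2) t.2.1 (by ring)
    exact ⟨hs, faces_of_subset h (carrier_combination_subset _ _ _ _) (carrier_nonempty hs)⟩⟩
  continuous_toFun := by fun_prop
  source' := by ext; simp
  target' := by ext; simp

lemma straightPath_mem_closedStar {a b : geomRealization Z}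
    (h : carrier a.1 ∪ carrier b.1 ∈ Z.faces) {v : V}
    (hv : insert v (carrier a.1 ∪ carrier b.1) ∈ Z.faces) (t : unitInterval) :
    (straightPath a b h t : V → ℝ) ∈ closedStar Z v :=
  ⟨(straightPath a b h t).2.1, faces_of_subset hv
    (Finset.insert_subset_insert _ (carrier_combination_subset _ _ _ _)) (by simp)⟩

section Transport

variable {G : Type*} [Group G] {x₀ : geomRealization Z}
  (ρ : FundamentalGroup (geomRealization Z) x₀ →* G)

open Classical in
/-- Holonomy along the straight path from `a` to `b`, when these points lie in a common simplex. -/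
noncomputable def straightHolonomy (a b : geomRealization Z) : G :=
  if h : carrier a.1 ∪ carrier b.1 ∈ Z.faces then holonomy ρ (straightPath a b h) else 1

/-- Inside a closed star, transport does not depend on the path. -/
lemma holonomy_mul_straightHolonomy {a b c : geomRealization Z} {v : V}
    (hab : insert v (carrier a.1 ∪ carrier b.1) ∈ Z.faces)
    (hac : insert v (carrier a.1 ∪ carrier c.1) ∈ Z.faces) (p : Path b c)
    (hp : ∀ t, (p t : V → ℝ) ∈ closedStar Z v) :
    holonomy ρ p * straightHolonomy ρ a b = straightHolonomy ρ a c := by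
  have hne : ∀ x y : geomRealization Z, (carrier x.1 ∪ carrier y.1).Nonempty := fun x y =>
    (carrier_nonempty x.2.1).mono Finset.subset_union_left
  have hab' := faces_of_subset hab (Finset.subset_insert _ _) (hne a b)
  have hac' := faces_of_subset hac (Finset.subset_insert _ _) (hne a c)
  rw [straightHolonomy, straightHolonomy, dif_pos hab', dif_pos hac', ← holonomy_trans]
  refine holonomy_congr ρ (homotopic_of_mem_closedStar (v := v) _ _ (fun t => ?_)
    (straightPath_mem_closedStar hac' hac))
  have ht : ((straightPath a b hab').trans p) t ∈ Set.range ((straightPath a b hab').trans p) :=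
    ⟨t, rfl⟩
  rw [Path.trans_range] at ht
  rcases ht with ⟨s, hs⟩ | ⟨s, hs⟩ <;> rw [← hs]
  exacts [straightPath_mem_closedStar hab' hab s, hp s]

lemma straightHolonomy_mul {a b c : geomRealization Z} {σ : Finset V} (hσ : σ ∈ Z.faces)
    (ha : carrier a.1 ⊆ σ) (hb : carrier b.1 ⊆ σ) (hc : carrier c.1 ⊆ σ) :
    straightHolonomy ρ b c * straightHolonomy ρ a b = straightHolonomy ρ a c := by
  obtain ⟨v, hv⟩ := carrier_nonempty a.2.1
  have hface : ∀ x y : geomRealization Z, carrier x.1 ⊆ σ → carrier y.1 ⊆ σ →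
      insert v (carrier x.1 ∪ carrier y.1) ∈ Z.faces := fun x y hx hy =>
    faces_of_subset hσ (Finset.insert_subset (ha hv) (Finset.union_subset hx hy)) (by simp)
  have hbc : carrier b.1 ∪ carrier c.1 ∈ Z.faces :=
    faces_of_subset hσ (Finset.union_subset hb hc)
      ((carrier_nonempty b.2.1).mono Finset.subset_union_left)
  rw [← holonomy_mul_straightHolonomy ρ (hface a b ha hb) (hface a c ha hc)
    (straightPath b c hbc) (straightPath_mem_closedStar hbc (hface b c hb hc)),
    straightHolonomy, dif_pos hbc]

end Transport

end Realization

section FixedPoint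

variable {V : Type*} [Fintype V] [DecidableEq V] (Z : AbstractSimplicialComplex V)

/-- The vertex `v` as a point of the geometric realization. -/
def vertexPoint (v : V) : geomRealization Z.toPreAbstractSimplicialComplex :=
  ⟨Pi.single v 1, single_mem_stdSimplex ℝ v, by
    have := carrier_single v ▸ Z.singleton_mem v
    exact this⟩

variable {Z} {Y : Type*} [MetricSpace Y]
  {x₀ : geomRealization Z.toPreAbstractSimplicialComplex}
  (ρ : FundamentalGroup (geomRealization Z.toPreAbstractSimplicialComplex) x₀ →* (Y ≃ᵢ Y))

lemma carrier_vertexPoint (v : V) : carrier (vertexPoint Z v).1 = {v} := carrier_single v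

lemma isFlat_straightHolonomy : IsFlat Z.toPreAbstractSimplicialComplex
    fun v w => straightHolonomy ρ (vertexPoint Z w) (vertexPoint Z v) := by
  intro σ hσ u hu v hv w hw
  refine straightHolonomy_mul ρ hσ ?_ ?_ ?_ <;> simpa [carrier_vertexPoint]

/-- A flat section over the vertices extends to the points of the geometric realization, by
transport along straight paths, and the extension is preserved by the holonomy of all paths: cut
the path into pieces contained in open stars. -/
lemma exists_parallel_extension {f : V → Y}
    (hf : ∀ v w, {v, w} ∈ Z.faces →
      f v = straightHolonomy ρ (vertexPoint Z w) (vertexPoint Z v) (f w)) :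
    ∃ s : geomRealization Z.toPreAbstractSimplicialComplex → Y,
      ∀ (a b) (p : Path a b), holonomy ρ p (s a) = s b := by
  choose u hu using fun a : geomRealization Z.toPreAbstractSimplicialComplex =>
    carrier_nonempty a.2.1
  set s : geomRealization Z.toPreAbstractSimplicialComplex → Y := fun a =>
    straightHolonomy ρ (vertexPoint Z (u a)) a (f (u a)) with hs
  have hsv : ∀ a, ∀ v ∈ carrier a.1, straightHolonomy ρ (vertexPoint Z v) a (f v) = s a := by
    intro a v hv
    have hface : {v, u a} ∈ Z.faces :=
      faces_of_subset (carrier_mem_faces a) (Finset.insert_subset hv (by simpa using hu a))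
        (by simp)
    rw [hf v (u a) hface, ← IsometryEquiv.mul_apply,
      straightHolonomy_mul ρ (carrier_mem_faces a) (by simpa [carrier_vertexPoint] using hu a)
        (by simpa [carrier_vertexPoint] using hv) subset_rfl]
  have hstar : ∀ (v : V) (a b) (p : Path a b), (∀ t, (p t).1 v ≠ 0) →
      holonomy ρ p (s a) = s b := by
    intro v a b p hp
    have ha : v ∈ carrier a.1 := mem_carrier.2 (by simpa using hp 0)
    have hb : v ∈ carrier b.1 := mem_carrier.2 (by simpa using hp 1)
    have hface : ∀ x : geomRealization Z.toPreAbstractSimplicialComplex, v ∈ carrier x.1 →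
        insert v (carrier (vertexPoint Z v).1 ∪ carrier x.1) ∈ Z.faces := by
      intro x hx
      have : insert v (carrier (vertexPoint Z v).1 ∪ carrier x.1) = carrier x.1 := by
        rw [carrier_vertexPoint, ← Finset.insert_eq, Finset.insert_eq_of_mem hx,
          Finset.insert_eq_of_mem hx]
      rw [this]
      exact carrier_mem_faces x
    rw [← hsv a v ha, ← hsv b v hb, ← IsometryEquiv.mul_apply,
      holonomy_mul_straightHolonomy ρ (hface a ha) (hface b hb)]
    intro t
    refine ⟨(p t).2.1, ?_⟩
    rw [Finset.insert_eq_of_mem (mem_carrier.2 (hp t))]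
    exact carrier_mem_faces _
  refine ⟨s, fun a b p => ?_⟩
  obtain ⟨t, ht0, hmono, ⟨n, hn⟩, hcover⟩ := exists_monotone_Icc_subset_open_cover_unitInterval
    (c := fun v : V => {r : unitInterval | (p r).1 v ≠ 0})
    (fun v => isOpen_ne.preimage
      ((continuous_apply v).comp (continuous_subtype_val.comp p.continuous)))
    (fun r _ => by
      obtain ⟨v, hv⟩ := carrier_nonempty (p r).2.1
      exact Set.mem_iUnion.2 ⟨v, mem_carrier.1 hv⟩)
  have key : ∀ k, holonomy ρ (p.subpath (t 0) (t k)) (s (p (t 0))) = s (p (t k)) := by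
    intro k
    induction k with
    | zero =>
      obtain ⟨v, hv⟩ := carrier_nonempty (p (t 0)).2.1
      refine hstar v _ _ _ fun r => ?_
      rw [Path.subpath_self]
      exact mem_carrier.1 hv
    | succ k ih =>
      obtain ⟨v, hv⟩ := hcover k
      rw [← holonomy_congr ρ ⟨Path.Homotopy.subpathTransSubpath p (t 0) (t k) (t (k + 1))⟩,
        holonomy_trans, IsometryEquiv.mul_apply, ih]
      refine hstar v _ _ _ fun r => ?_
      have hr : p.subpath (t k) (t (k + 1)) r ∈ p '' Set.Icc (t k) (t (k + 1)) := by
        rw [← Path.range_subpath_of_le p _ _ (hmono k.le_succ)]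
        exact ⟨r, rfl⟩
      obtain ⟨r', hr', h⟩ := hr
      rw [← h]
      exact hv hr'
  have h1 := key n
  rw [hn n le_rfl, ht0, Path.subpath_zero_one] at h1
  have hcast : ∀ {a' b'} (ha : a' = a) (hb : b' = b),
      holonomy ρ (p.cast ha hb) (s a') = s b' → holonomy ρ p (s a) = s b := by
    rintro _ _ rfl rfl h
    exact h
  exact hcast _ _ h1

end FixedPoint

theorem mainTheorem4 {V : Type*} [Fintype V] [DecidableEq V]
    (Z : AbstractSimplicialComplex V) (m : Finset V → ℝ)
    (hm : IsWeight Z.toPreAbstractSimplicialComplex m)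
    (x₀ : geomRealization Z.toPreAbstractSimplicialComplex)
    {Y : Type*} [MetricSpace Y] [CompleteSpace Y] [Nonempty Y] (hY : IsCAT0 Y)
    (hspec : ∃ l : ℝ, 1 / 2 < l ∧ ∀ (z : V) (y : Y),
      (l : EReal) ≤ spectrumBottom (linkComplex Z.toPreAbstractSimplicialComplex z)
        (linkWeight m z) (TangentCone y))
    (ρ : FundamentalGroup (geomRealization Z.toPreAbstractSimplicialComplex) x₀ →* (Y ≃ᵢ Y)) :
    ∃ y : Y, ∀ γ : FundamentalGroup (geomRealization Z.toPreAbstractSimplicialComplex) x₀,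
      ρ γ y = y := by
  obtain ⟨l, hl2, hl⟩ := hspec
  obtain ⟨f, hf⟩ := exists_flat_section hm hY hl2 hl (isFlat_straightHolonomy ρ)
  obtain ⟨s, hs⟩ := exists_parallel_extension ρ hf
  refine ⟨s x₀, fun γ => ?_⟩
  obtain ⟨p, hp⟩ := exists_holonomy_eq ρ γ
  rw [← hp]
  exact hs x₀ x₀ p
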